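/- **Setting.** Let $p\in[0,1]$, $\rho=12$, $\alpha=\sqrt{54}$, $Z(2)=\tfrac43$ and $Z(2m)=\frac{8^m(3m-4)!}{(m-2)!\,(2m)!}$ for $m\ge2$. Put $q_{-1}=(\alpha/\rho)^2=\tfrac38$, $q_{2k}=q_{2k+1}=Z(2k+2)\rho^{-1}\alpha^{-2k}$ and $q_{2i+1,2j+1}=(\rho/\alpha)^2q_{2i}q_{2j}$ for $k,i,j\ge0$. *Peeling moves.* Peeling a boundary edge of the uniform infinite half-planar quadrangulation reveals a face of one of the following types. It swallows $R^-$ boundary edges to the left of the peeled edge and exposes $e$ new vertices. - Both further vertices of the face are inner: probability $q_{-1}$, $R^-=0$, $e=2$. - Exactly one further vertex is on the boundary, at distance $k\ge0$ to the left (respectively right): probability $q_k$ each, $R^-=k$ (respectively $R^-=0$), with $e=1$ if $k$ is odd and $e=0$ if $k$ is even. - Both further vertices are on the boundary: for each $i,j\ge0$, probability $q_{2i+1,2j+1}$ for each of the three cases both left ($R^-=2i+2j+2$), one on each side (distance $2i+1$ on the left and $2j+1$ on the right, $R^-=2i+1$) and both right ($R^-=0$); here $e=0$. These probabilities sum to $1$.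 Each exposed vertex is coloured white ($\circ$) with probability $p$ and black ($\bullet$) with probability $1-p$, independently of everything else. The moves (face and colours) at different times are i.i.d. *The mixed boundary.* Let $\hat\Sigma\subset\{\bullet,\circ\}^{\{1,2,\dots\}}$ be the set of sequences $\xi$ with $\xi(1)=\bullet$ and no two adjacent $\circ$'s, with the product topology and its Borel $\sigma$-algebra. The mixed-boundary chain $(X_n)_{n\ge0}$ on $\hat\Sigma$ evolves as follows. Given $X_n$ and an independent peeling move, delete the first $R^-$ entries of $X_n$, put the colours of the $e$ exposed vertices, listed from right to left, in front of the remaining sequence, and delete all entries preceding the first $\bullet$; the result is $X_{n+1}$. *The flagged chain.* Let $\hat\Sigma^*$ be the countable set of finite non-empty $\{\bullet,\circ\}$-words with first letter $\bullet$ and no two adjacent $\circ$'s. The chain $(X^*_n)_{n\ge0}$ on $\hat\Sigma^*$ starts from $X_0^*=\bullet$ (the word of length one) and is driven by the same moves. If $R^-$ is at least the length of $X^*_n$ then $X^*_{n+1}=\bullet$. Otherwise $X^*_{n+1}$ is obtained from $X^*_n$ by the rule above for $X_n$ (and is $\bullet$ if that leaves the empty word). The chain is called transient if, almost surely, it visits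 its initial state $\bullet$ only finitely often. It is called null-recurrent if, almost surely, it visits $\bullet$ infinitely often but the expected first return time to $\bullet$ is infinite. For a probability measure $\nu$ on $\hat\Sigma$ let $[\nu]_k$ be the law of the first $k$ coordinates under $\nu$, and let $\|\mu-\nu\|_{\mathrm{TV}}=\sup_A|\mu(A)-\nu(A)|$, the supremum being over measurable sets $A$. **Proposition 3.4.** Suppose that $(X^*_n)$ is transient or null-recurrent. Then the chain $(X_n)$ has exactly one invariant probability measure $\mu$ on $\hat\Sigma$. Moreover, for every (random or deterministic) initial state $X_0=\xi\in\hat\Sigma$ independent of the peeling moves, and for every $k\ge1$, $$\big\|[X_n]_k-[\mu]_k\big\|_{\mathrm{TV}}\longrightarrow0\qquad\text{as }n\to\infty,$$ where $[X_n]_k$ denotes the law of the first $k$ coordinates of $X_n$; and $X_n$ converges in law to $\mu$. -/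

import Mathlib

open Filter Topology MeasureTheory ProbabilityTheory
open scoped ENNReal

noncomputable section

namespace Peeling

/-! ### A summation needed to know that the peeling probabilities add up to one -/

theorem hyp_hasDerivAt {d : ℕ → ℝ} (h : ∀ j, |d j| ≤ 1) {x : ℝ} (hx : |x| < 1) :
    HasDerivAt (fun y => ∑' j, d j * y ^ j) (∑' j, d j * (j * x ^ (j - 1))) x := by
  obtain ⟨r, hxr, hr1⟩ := exists_between hx
  have hr0 : 0 ≤ r := (abs_nonneg x).trans hxr.le
  have hs : Summable fun j : ℕ => (j : ℝ) * r ^ (j - 1) := by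
    rw [← summable_nat_add_iff 1]
    have h1 := summable_pow_mul_geometric_of_norm_lt_one 1
      (r := r) (by rwa [Real.norm_eq_abs, abs_of_nonneg hr0])
    have h2 := summable_geometric_of_lt_one hr0 hr1
    refine (h1.add h2).congr fun j => ?_
    push_cast
    simp
    ring
  refine hasDerivAt_tsum_of_isPreconnected (g := fun (j : ℕ) (y : ℝ) => d j * y ^ j)
    (g' := fun (j : ℕ) (y : ℝ) => d j * (j * y ^ (j - 1))) (t := Metric.ball (0 : ℝ) r) (y₀ := (0 : ℝ)) hs
    Metric.isOpen_ball (convex_ball _ _).isPreconnected (fun j y _ => ?_) (fun j y hy => ?_) ?_ ?_ ?_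
  · exact (hasDerivAt_pow j y).const_mul (d j)
  · rw [Real.norm_eq_abs, abs_mul, abs_mul, abs_pow, Nat.abs_cast]
    have hy' : |y| ≤ r := by simpa using (Metric.mem_ball.1 hy).le
    calc |d j| * (j * |y| ^ (j - 1)) ≤ 1 * (j * r ^ (j - 1)) := by
          gcongr
          exact h j
      _ = _ := one_mul _
  · simpa using (abs_nonneg x).trans_lt hxr
  · refine summable_of_ne_finset_zero (s := {0}) fun j hj => ?_
    have : j ≠ 0 := by simpa using hj
    simp [this]
  · simpa using hxr

theorem hyp_summable {d : ℕ → ℝ} (h : ∀ j, |d j| ≤ 1) {x : ℝ} (hx : |x| < 1) :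
    Summable fun j : ℕ => d j * (j * x ^ j) := by
  have h1 := summable_pow_mul_geometric_of_norm_lt_one 1 (r := |x|) (by simpa using hx)
  refine Summable.of_norm_bounded h1 fun j => ?_
  rw [Real.norm_eq_abs, abs_mul, abs_mul, abs_pow, Nat.abs_cast, pow_one]
  exact mul_le_of_le_one_left (by positivity) (h j)

theorem hyp_summable' {d : ℕ → ℝ} (h : ∀ j, |d j| ≤ 1) {x : ℝ} (hx : |x| < 1) :
    Summable fun j : ℕ => d j * x ^ j := by
  have h1 := summable_geometric_of_abs_lt_one (r := |x|) (by simpa using hx)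
  refine Summable.of_norm_bounded h1 fun j => ?_
  rw [Real.norm_eq_abs, abs_mul, abs_pow]
  exact mul_le_of_le_one_left (by positivity) (h j)

/-- The hypergeometric sum `₂F₁(-2/3, -1/3; 1/2; 1) = 3/2`. -/
theorem hyp_hasSum (a : ℕ → ℝ) (h0 : a 0 = 1)
    (hrec : ∀ j : ℕ, a (j + 1) * ((j + 1 / 2) * (j + 1)) = a j * ((j - 2 / 3) * (j - 1 / 3))) :
    HasSum a (3 / 2) := by
  have h1 : a 1 = 4 / 9 := by have := hrec 0; norm_num [h0] at this; linarith
  have hb : ∀ j : ℕ, 0 ≤ a (j + 1) ∧ (j + 1) * a (j + 1) ≤ 4 / 9 ∧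
      (j + 1) * (j + 1 / 2) * a (j + 1) ≤ 2 / 9 := by
    intro j
    induction j with
    | zero => norm_num [h1]
    | succ j ih =>
      obtain ⟨i1, i2, i3⟩ := ih
      have hr := hrec (j + 1)
      push_cast at hr ⊢
      have hj : (0 : ℝ) ≤ j := j.cast_nonneg
      have e : a (j + 1 + 1) = a (j + 1) * ((j + 1 / 3) * (j + 2 / 3)) /
          ((j + 3 / 2) * (j + 2)) := by
        rw [eq_div_iff (by positivity)]; linear_combination hr
      refine ⟨by rw [e]; positivity, le_trans ?_ i2, le_trans ?_ i3⟩
      · rw [e, mul_div_assoc', div_le_iff₀ (by positivity)]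
        have : 0 ≤ a (j + 1) * (j + 2) * ((j + 1) * (j + 3 / 2) - (j + 1 / 3) * (j + 2 / 3)) := by
          have : (0 : ℝ) ≤ (j + 1) * (j + 3 / 2) - (j + 1 / 3) * (j + 2 / 3) := by nlinarith
          positivity
        nlinarith
      · rw [e, mul_div_assoc', div_le_iff₀ (by positivity)]
        have : 0 ≤ a (j + 1) * ((j + 2) * (j + 3 / 2)) *
            ((j + 1) * (j + 1 / 2) - (j + 1 / 3) * (j + 2 / 3)) := by
          have : (0 : ℝ) ≤ (j + 1) * (j + 1 / 2) - (j + 1 / 3) * (j + 2 / 3) := by nlinarith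
          positivity
        nlinarith
  have hn : ∀ j, 0 ≤ a j := fun j => by
    cases j with
    | zero => rw [h0]; norm_num
    | succ j => exact (hb j).1
  have hsum : Summable a := by
    rw [← summable_nat_add_iff 1]
    have h2 : Summable fun j : ℕ => 1 / ((j + 1 : ℕ) : ℝ) ^ 2 :=
      (summable_nat_add_iff 1).2 (Real.summable_one_div_nat_pow.2 one_lt_two)
    refine Summable.of_nonneg_of_le (fun j => (hb j).1) (fun j => ?_) h2
    have hj : (0 : ℝ) ≤ j := j.cast_nonneg
    rw [le_div_iff₀ (by positivity)]
    push_cast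
    nlinarith [(hb j).2.2, (hb j).1, mul_nonneg (hb j).1 hj,
      mul_nonneg (mul_nonneg (hb j).1 hj) hj]
  have ha1 : ∀ j, |a j| ≤ 1 := fun j => by
    rw [abs_of_nonneg (hn j)]
    cases j with
    | zero => rw [h0]
    | succ j =>
      have := (hb j).2.1
      nlinarith [(hb j).1, mul_nonneg (hb j).1 (j.cast_nonneg (α := ℝ))]
  set b : ℕ → ℝ := fun j => (j + 1) * a (j + 1) with hbdef
  have hb1 : ∀ j, |b j| ≤ 1 := fun j => by
    rw [abs_of_nonneg (mul_nonneg (by positivity) (hb j).1)]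
    linarith [(hb j).2.1]
  set F : ℝ → ℝ := fun x => ∑' j, a j * x ^ j with hF
  set G : ℝ → ℝ := fun x => ∑' j, b j * x ^ j with hG
  set H : ℝ → ℝ := fun x => ∑' j, b j * (j * x ^ (j - 1)) with hH
  have dF : ∀ x, |x| < 1 → HasDerivAt F (G x) x := fun x hx => by
    convert hyp_hasDerivAt ha1 hx using 1
    rw [tsum_eq_zero_add']
    · simp only [hG, hbdef]
      simp [mul_comm, mul_left_comm]
    · refine (hyp_summable' hb1 hx).congr fun j => ?_
      simp [hbdef]; ring
  have dG : ∀ x, |x| < 1 → HasDerivAt G (H x) x := fun x hx => hyp_hasDerivAt hb1 hx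
  have ode : ∀ x, |x| < 1 → x * (1 - x) * H x + G x / 2 - 2 / 9 * F x = 0 := by
    intro x hx
    have e1 : x * H x = ∑' j, b j * (j * x ^ j) := by
      rw [hH, ← tsum_mul_left]
      refine tsum_congr fun j => ?_
      cases j with
      | zero => simp
      | succ j => simp; ring
    have s1 := hyp_summable hb1 hx
    have e2 : x * (x * H x) = ∑' j, a j * (j * (j - 1) * x ^ j) := by
      rw [e1, ← tsum_mul_left, tsum_eq_zero_add' (f := fun j => a j * (j * (j - 1) * x ^ j))]
      · simp only [hbdef]
        simp
        refine tsum_congr fun j => ?_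
        ring
      · refine (s1.mul_left x).congr fun j => ?_
        simp [hbdef]; ring
    have s2 : Summable fun j : ℕ => a j * (j * (j - 1) * x ^ j) := by
      rw [← summable_nat_add_iff 1]
      refine (s1.mul_left x).congr fun j => ?_
      simp [hbdef]; ring
    have s3 := hyp_summable' hb1 hx
    have s4 := hyp_summable' ha1 hx
    have : x * (1 - x) * H x + G x / 2 - 2 / 9 * F x
        = (∑' j, b j * (j * x ^ j)) - (∑' j, a j * (j * (j - 1) * x ^ j))
          + (1 / 2) * G x - 2 / 9 * F x := by
      rw [← e1, ← e2]; ring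
    rw [this, hG, hF]
    simp only []
    rw [← tsum_mul_left, ← tsum_mul_left, ← s1.tsum_sub s2, ← (s1.sub s2).tsum_add (s3.mul_left _),
      ← ((s1.sub s2).add (s3.mul_left _)).tsum_sub (s4.mul_left _)]
    refine (tsum_congr fun j => ?_).trans tsum_zero
    simp only [hbdef]
    linear_combination x ^ j * hrec j
  -- the explicit solution, in the variable x = sin² (3 φ)
  set Y : ℝ → ℝ := fun φ => 2 * Real.cos (2 * φ) - Real.cos (4 * φ) with hY
  have c4 : ∀ φ : ℝ, Real.cos (4 * φ) = 2 * Real.cos (2 * φ) ^ 2 - 1 := fun φ => by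
    rw [← Real.cos_two_mul]; ring_nf
  have hYpos : ∀ φ ∈ Set.Icc 0 (Real.pi / 6), 0 < Y φ := fun φ hφ => by
    have : 1 / 2 ≤ Real.cos (2 * φ) := by
      rw [← Real.cos_pi_div_three]
      exact Real.cos_le_cos_of_nonneg_of_le_pi (by linarith [hφ.1])
        (by linarith [Real.pi_pos]) (by linarith [hφ.2])
    have h' := Real.cos_le_one (2 * φ)
    simp only [hY, c4]
    nlinarith
  have hs1 : ∀ φ : ℝ, 0 < Real.cos (3 * φ) → |Real.sin (3 * φ) ^ 2| < 1 := fun φ h => by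
    rw [abs_of_nonneg (sq_nonneg _)]
    nlinarith [Real.sin_sq_add_cos_sq (3 * φ)]
  have key : ∀ φ ∈ Set.Ico 0 (Real.pi / 6), F (Real.sin (3 * φ) ^ 2) = Y φ := by
    intro φ hφ
    have hcos : ∀ t ∈ Set.Icc 0 φ, 0 < Real.cos (3 * t) := fun t ht =>
      Real.cos_pos_of_mem_Ioo ⟨by linarith [ht.1, Real.pi_pos], by linarith [ht.2, hφ.2]⟩
    -- derivatives
    have ds : ∀ t : ℝ, HasDerivAt (fun t => Real.sin (3 * t) ^ 2)
        (6 * Real.sin (3 * t) * Real.cos (3 * t)) t := fun t => by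
      have := (((hasDerivAt_id t).const_mul 3).sin).pow 2
      convert! this using 1
      simp; ring
    have dY : ∀ t : ℝ, HasDerivAt Y (4 * Real.sin (4 * t) - 4 * Real.sin (2 * t)) t := fun t => by
      have e1 := (((hasDerivAt_id t).const_mul 2).cos).const_mul 2
      have e2 := ((hasDerivAt_id t).const_mul 4).cos
      convert! e1.sub e2 using 1
      simp; ring
    have dY' : ∀ t : ℝ, HasDerivAt (fun t => 4 * Real.sin (4 * t) - 4 * Real.sin (2 * t))
        (16 * Real.cos (4 * t) - 8 * Real.cos (2 * t)) t := fun t => by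
      have e1 := (((hasDerivAt_id t).const_mul 2).sin).const_mul 4
      have e2 := (((hasDerivAt_id t).const_mul 4).sin).const_mul 4
      convert! e2.sub e1 using 1
      simp; ring
    have dc : ∀ t : ℝ, HasDerivAt (fun t => Real.cos (3 * t)) (-(3 * Real.sin (3 * t))) t :=
      fun t => by
        convert! ((hasDerivAt_id t).const_mul 3).cos using 1
        simp; ring
    have dsin : ∀ t : ℝ, HasDerivAt (fun t => Real.sin (3 * t)) (3 * Real.cos (3 * t)) t :=
      fun t => by
        convert! ((hasDerivAt_id t).const_mul 3).sin using 1
        simp; ring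
    have dFs : ∀ t ∈ Set.Icc 0 φ, HasDerivAt (fun t => F (Real.sin (3 * t) ^ 2))
        (G (Real.sin (3 * t) ^ 2) * (6 * Real.sin (3 * t) * Real.cos (3 * t))) t := fun t ht =>
      HasDerivAt.comp (h₂ := F) t (dF _ (hs1 t (hcos t ht))) (ds t)
    have dGs : ∀ t ∈ Set.Icc 0 φ, HasDerivAt (fun t => G (Real.sin (3 * t) ^ 2))
        (H (Real.sin (3 * t) ^ 2) * (6 * Real.sin (3 * t) * Real.cos (3 * t))) t := fun t ht =>
      HasDerivAt.comp (h₂ := G) t (dG _ (hs1 t (hcos t ht))) (ds t)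
    -- Wronskian divided by cos²
    set W : ℝ → ℝ := fun t =>
      (G (Real.sin (3 * t) ^ 2) * (6 * Real.sin (3 * t) * Real.cos (3 * t)) * Y t -
        F (Real.sin (3 * t) ^ 2) * (4 * Real.sin (4 * t) - 4 * Real.sin (2 * t))) /
          Real.cos (3 * t) ^ 2 with hW
    have dW : ∀ t ∈ Set.Icc 0 φ, HasDerivAt W 0 t := by
      intro t ht
      have hc := hcos t ht
      have e := (((((dGs t ht).mul (((dsin t).const_mul 6).mul (dc t))).mul (dY t)).sub
        ((dFs t ht).mul (dY' t))).div ((dc t).pow 2) (pow_ne_zero 2 hc.ne'))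
      convert! e using 1
      symm
      simp only [Pi.mul_apply, Pi.sub_apply, Pi.pow_apply]
      rw [div_eq_zero_iff]
      left
      have o := ode _ (hs1 t hc)
      have q : Real.cos (3 * t) ^ 2 = 1 - Real.sin (3 * t) ^ 2 := by
        linarith [Real.sin_sq_add_cos_sq (3 * t)]
      have r1 : Real.cos (4 * t) - Real.cos (2 * t) = -2 * Real.sin (3 * t) * Real.sin t := by
        rw [Real.cos_sub_cos]; ring_nf
      have r2 : Real.sin (4 * t) - Real.sin (2 * t) = 2 * Real.sin t * Real.cos (3 * t) := by
        rw [Real.sin_sub_sin]; ring_nf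
      have f1 : 4 * Real.sin (4 * t) - 4 * Real.sin (2 * t) = 8 * Real.sin t * Real.cos (3 * t) := by
        linarith
      have f2 : 16 * Real.cos (4 * t) - 8 * Real.cos (2 * t)
          = 8 * Y t - 48 * Real.sin (3 * t) * Real.sin t := by
        simp only [hY]; linarith
      rw [f1, f2]
      generalize Real.sin (3 * t) = s at *
      generalize Real.cos (3 * t) = c at *
      generalize Real.sin t = u at *
      generalize Y t = y at *
      generalize F (s ^ 2) = f at *
      generalize G (s ^ 2) = g at *
      generalize H (s ^ 2) = h at *
      have hh : s ^ 2 * c ^ 2 * h = 2 / 9 * f - g / 2 := by rw [q]; linarith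
      push_cast
      simp only [pow_one]
      linear_combination (36 * y * c ^ 2) * hh + 18 * g * y * c ^ 2 * q
    have W0 : ∀ t ∈ Set.Icc 0 φ, W t = 0 := by
      intro t ht
      rw [constant_of_has_deriv_right_zero
        (fun t ht => (dW t ht).continuousAt.continuousWithinAt)
        (fun t ht => (dW t (Set.Ico_subset_Icc_self ht)).hasDerivWithinAt) t ht]
      simp [hW]
    have hYp : ∀ t ∈ Set.Icc 0 φ, 0 < Y t := fun t ht =>
      hYpos t ⟨ht.1, ht.2.trans hφ.2.le⟩
    have dR : ∀ t ∈ Set.Icc 0 φ,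
        HasDerivAt (fun t => F (Real.sin (3 * t) ^ 2) / Y t) 0 t := by
      intro t ht
      have e := (dFs t ht).div (dY t) (hYp t ht).ne'
      convert! e using 1
      have w := W0 t ht
      simp only [hW] at w
      rw [div_eq_zero_iff] at w
      rw [w.resolve_right (pow_ne_zero 2 (hcos t ht).ne'), zero_div]
    have F0 : F 0 = 1 := by
      simp only [hF]
      rw [tsum_eq_single 0 (fun j hj => by simp [hj])]
      simp [h0]
    have hR := constant_of_has_deriv_right_zero
      (fun t ht => (dR t ht).continuousAt.continuousWithinAt)
      (fun t ht => (dR t (Set.Ico_subset_Icc_self ht)).hasDerivWithinAt) φ ⟨hφ.1, le_rfl⟩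
    have hp := hYp φ ⟨hφ.1, le_rfl⟩
    have Y0 : Y 0 = 1 := by simp [hY]; norm_num
    simp only [mul_zero, Real.sin_zero, ne_eq, OfNat.ofNat_ne_zero, not_false_eq_true, zero_pow,
      F0, Y0, div_one] at hR
    rwa [div_eq_one_iff_eq hp.ne'] at hR
  have hpi : (0 : ℝ) < Real.pi / 6 := by linarith [Real.pi_pos]
  have cF : ContinuousOn F (Set.Icc 0 1) := by
    refine continuousOn_tsum (fun j => by fun_prop) hsum fun j x hx => ?_
    rw [Real.norm_eq_abs, abs_mul, abs_of_nonneg (hn j), abs_of_nonneg (pow_nonneg hx.1 j)]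
    exact mul_le_of_le_one_right (hn j) (pow_le_one₀ hx.1 hx.2)
  have cL : Continuous fun φ => F (Real.sin (3 * φ) ^ 2) :=
    cF.comp_continuous (by fun_prop) fun φ =>
      ⟨sq_nonneg _, by nlinarith [Real.sin_sq_add_cos_sq (3 * φ), sq_nonneg (Real.cos (3 * φ))]⟩
  have cY : Continuous Y := by fun_prop
  have hend : F (Real.sin (3 * (Real.pi / 6)) ^ 2) = Y (Real.pi / 6) := by
    have hcl : Real.pi / 6 ∈ closure (Set.Ico 0 (Real.pi / 6)) := by
      rw [closure_Ico hpi.ne]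
      exact ⟨hpi.le, le_rfl⟩
    have : Set.EqOn (fun φ => F (Real.sin (3 * φ) ^ 2)) Y (Set.Ico 0 (Real.pi / 6)) := key
    exact this.closure cL cY hcl
  have e1 : (3 : ℝ) * (Real.pi / 6) = Real.pi / 2 := by ring
  have e2 : (2 : ℝ) * (Real.pi / 6) = Real.pi / 3 := by ring
  have hY6 : Y (Real.pi / 6) = 3 / 2 := by
    simp only [hY, c4, e2, Real.cos_pi_div_three]
    norm_num
  rw [e1, Real.sin_pi_div_two, hY6] at hend
  have : ∑' j, a j = 3 / 2 := by
    rw [← hend]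
    simp [hF]
  rw [← this]
  exact hsum.hasSum

/-! ### The peeling probabilities -/

/-- The constant `ρ = 12`. -/
def rho : ℝ := 12

/-- The constant `α = √54`. -/
def alpha : ℝ := √54

/-- `Z m` is the value `Z(2m)`, `m ≥ 1`, of the generating function of quadrangulations of a
`2m`-gon at the critical point `1/ρ`; `Z(2) = 4/3` is the limiting value of the formula. -/
def Z (m : ℕ) : ℝ :=
  if m = 1 then 4 / 3
  else 8 ^ m * ((3 * m - 4).factorial : ℝ) / ((m - 2).factorial * (2 * m).factorial)

/-- `q_{2k} = q_{2k+1} = Z(2k+2) ρ⁻¹ α^{-2k}`. -/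
def q (n : ℕ) : ℝ := Z (n / 2 + 1) * rho⁻¹ * (alpha ^ (2 * (n / 2)))⁻¹

/-- `qTwo k₁ k₂` is `q_{2k₁+1, 2k₂+1} = (ρ/α)² q_{2k₁} q_{2k₂}`. -/
def qTwo (k₁ k₂ : ℕ) : ℝ := (rho / alpha) ^ 2 * q (2 * k₁) * q (2 * k₂)

/-- `q_{-1} = (α/ρ)²`. -/
def qNeg : ℝ := (alpha / rho) ^ 2

/-- The possible positions of the face discovered by a peeling step, relative to the boundary.
The peeled edge is `(r^L, r^R)`, and the remaining two vertices of the face are called `a, b`, so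
that its vertices are `r^L, a, b, r^R` in clockwise order. A distance to the left (right) is
measured along the boundary from `r^L` (from `r^R`).
* `inner`: `a` and `b` are both inner vertices.
* `left k`: exactly one further vertex is on the boundary, at distance `k` to the left. As the
  quadrangulation is bipartite, this vertex is `a` if `k` is odd, and then `b` is exposed; it
  is `b` if `k` is even, and then `a` is enclosed by the face, hence not exposed.
* `right k`: the mirror image of `left k`.
* `leftLeft i j`: both are on the boundary to the left, `a` at distance `2i+1` from `r^L`, and
  `b` at distance `2j+1` from `a`.
* `leftRight i j`: both are on the boundary, `a` at distance `2i+1` to the left and `b` at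
  distance `2j+1` to the right.
* `rightRight i j`: the mirror image of `leftLeft i j`. -/
inductive Face where
  | inner : Face
  | left : ℕ → Face
  | right : ℕ → Face
  | leftLeft : ℕ → ℕ → Face
  | leftRight : ℕ → ℕ → Face
  | rightRight : ℕ → ℕ → Face

/-- The probability of each position of the discovered face. -/
def Face.prob : Face → ℝ
  | .inner => qNeg
  | .left k => q k
  | .right k => q k
  | .leftLeft i j => qTwo i j
  | .leftRight i j => qTwo i j
  | .rightRight i j => qTwo i j

/-- The number `R⁻` of boundary edges to the left of the peeled edge that are swallowed. -/
def Face.swallowedLeft : Face → ℕ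
  | .inner => 0
  | .left k => k
  | .right _ => 0
  | .leftLeft i j => (2 * i + 1) + (2 * j + 1)
  | .leftRight i _ => 2 * i + 1
  | .rightRight _ _ => 0

/-- The number `E - 1` of exposed vertices, where `E` is the number of exposed edges. -/
def Face.exposed : Face → ℕ
  | .inner => 2
  | .left k => if Odd k then 1 else 0
  | .right k => if Odd k then 1 else 0
  | .leftLeft _ _ => 0
  | .leftRight _ _ => 0
  | .rightRight _ _ => 0

def Face.equivSum :
    Face ≃ Unit ⊕ (ℕ ⊕ ℕ) ⊕ (ℕ × ℕ) ⊕ (ℕ × ℕ) ⊕ (ℕ × ℕ) where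
  toFun
    | .inner => .inl ()
    | .left k => .inr (.inl (.inl k))
    | .right k => .inr (.inl (.inr k))
    | .leftLeft i j => .inr (.inr (.inl (i, j)))
    | .leftRight i j => .inr (.inr (.inr (.inl (i, j))))
    | .rightRight i j => .inr (.inr (.inr (.inr (i, j))))
  invFun
    | .inl _ => .inner
    | .inr (.inl (.inl k)) => .left k
    | .inr (.inl (.inr k)) => .right k
    | .inr (.inr (.inl (i, j))) => .leftLeft i j
    | .inr (.inr (.inr (.inl (i, j)))) => .leftRight i j
    | .inr (.inr (.inr (.inr (i, j)))) => .rightRight i j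
  left_inv f := by cases f <;> rfl
  right_inv x := by
    rcases x with _ | (_ | _) | ⟨_, _⟩ | ⟨_, _⟩ | ⟨_, _⟩ <;> rfl

instance : Countable Face := Face.equivSum.injective.countable

instance : MeasurableSpace Face := ⊤

instance : DiscreteMeasurableSpace Face := ⟨fun _ => trivial⟩

theorem alpha_sq : alpha ^ 2 = 54 := Real.sq_sqrt (by norm_num)

theorem qNeg_eq : qNeg = 3 / 8 := by
  rw [qNeg, div_pow, alpha_sq, rho]; norm_num

theorem Z_nonneg (m : ℕ) : 0 ≤ Z m := by
  unfold Z; split_ifs <;> positivity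

theorem q_nonneg (n : ℕ) : 0 ≤ q n := by
  have := Z_nonneg (n / 2 + 1)
  unfold q rho alpha; positivity

theorem qTwo_nonneg (i j : ℕ) : 0 ≤ qTwo i j :=
  mul_nonneg (mul_nonneg (sq_nonneg _) (q_nonneg _)) (q_nonneg _)

theorem Face.prob_nonneg (f : Face) : 0 ≤ f.prob := by
  cases f <;> simp [Face.prob, q_nonneg, qTwo_nonneg, qNeg, sq_nonneg]

theorem q_even (k : ℕ) : q (2 * k) = Z (k + 1) / 12 / 54 ^ k := by
  rw [q, Nat.mul_div_cancel_left k two_pos, pow_mul, alpha_sq, rho]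
  ring

theorem q_odd (k : ℕ) : q (2 * k + 1) = q (2 * k) := by
  have : (2 * k + 1) / 2 = 2 * k / 2 := by omega
  simp only [q, this]

theorem q_even_zero : q (2 * 0) = 1 / 9 := by
  rw [q_even]; norm_num [Z]

theorem q_even_succ (k : ℕ) :
    q (2 * (k + 1)) * ((k + 3 / 2) * (k + 2)) = q (2 * k) * ((k + 1 / 3) * (k + 2 / 3)) := by
  rw [q_even, q_even]
  cases k with
  | zero => norm_num [Z, Nat.factorial]
  | succ k =>
    have e1 : 3 * (k + 1 + 1 + 1) - 4 = 3 * k + 5 := by omega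
    have e2 : 3 * (k + 1 + 1) - 4 = 3 * k + 2 := by omega
    have e3 : k + 1 + 1 + 1 - 2 = k + 1 := by omega
    have e4 : k + 1 + 1 - 2 = k := by omega
    have e5 : 2 * (k + 1 + 1 + 1) = 2 * k + 6 := by omega
    have e6 : 2 * (k + 1 + 1) = 2 * k + 4 := by omega
    simp only [Z, e1, e2, e3, e4, e5, e6, Nat.factorial_succ]
    simp
    field_simp
    ring

theorem hasSum_q_even : HasSum (fun k => q (2 * k)) (1 / 8) := by
  have h := hyp_hasSum (fun j => Nat.casesOn j 1 fun k => 4 * q (2 * k)) rfl (by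
    intro j
    cases j with
    | zero => simp only [q_even_zero]; norm_num
    | succ j =>
      have := q_even_succ j
      push_cast
      linear_combination 4 * this)
  have h' := ((hasSum_nat_add_iff' 1).2 h).mul_left (1 / 4)
  convert! h' using 1
  · funext k; simp
  · norm_num

theorem hasSum_q : HasSum q (1 / 4) := by
  have h := hasSum_q_even
  have h' : HasSum (fun k => q (2 * k + 1)) (1 / 8) := by simpa only [q_odd] using h
  convert! HasSum.even_add_odd h h' using 1
  norm_num

theorem hasSum_qTwo : HasSum (fun x : ℕ × ℕ => qTwo x.1 x.2) (1 / 24) := by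
  have h := hasSum_q_even
  have hs := h.summable
  have h2 := (h.mul h (hs.mul_of_nonneg hs (fun _ => q_nonneg _) fun _ => q_nonneg _)).mul_left
    ((rho / alpha) ^ 2)
  convert! h2 using 1
  · funext x; simp only [qTwo]; ring
  · rw [div_pow, alpha_sq, rho]; norm_num

theorem Face.hasSum_prob : HasSum Face.prob 1 := by
  rw [← Face.equivSum.symm.hasSum_iff]
  have e : (1 : ℝ) = qNeg + ((1 / 4 + 1 / 4) + (1 / 24 + (1 / 24 + 1 / 24))) := by
    rw [qNeg_eq]; norm_num
  rw [e]
  refine HasSum.sum ?_ (HasSum.sum (HasSum.sum ?_ ?_) (HasSum.sum ?_ (HasSum.sum ?_ ?_)))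
  · exact hasSum_unique _
  · exact hasSum_q
  · exact hasSum_q
  · exact hasSum_qTwo
  · exact hasSum_qTwo
  · exact hasSum_qTwo

/-- The law of the discovered face. -/
def faceLaw : PMF Face :=
  ⟨fun f => ENNReal.ofReal f.prob, by
    have h := Face.hasSum_prob
    have : ∑' f, ENNReal.ofReal (Face.prob f) = 1 := by
      rw [← ENNReal.ofReal_tsum_of_nonneg Face.prob_nonneg h.summable, h.tsum_eq, ENNReal.ofReal_one]
    exact this ▸ ENNReal.summable.hasSum⟩

/-! ### Peeling moves -/

/-- The colours of vertices. -/
abbrev Colour := Bool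

abbrev black : Colour := false

abbrev white : Colour := true

/-- A peeling move: the discovered face, together with two colours, of which as many are used, from
the first on, as there are exposed vertices. -/
abbrev Move := Face × Colour × Colour

/-- The colours of the exposed vertices, listed from right to left. -/
def Move.colours (m : Move) : List Colour := [m.2.1, m.2.2].take m.1.exposed

/-- The law of a peeling move: the colours are independent of the face and of each other, each
white with probability `p`. -/
def moveLaw (p : unitInterval) : Measure Move :=
  faceLaw.toMeasure.prod ((bernoulliMeasure white black p).prod (bernoulliMeasure white black p))

instance (p : unitInterval) : IsProbabilityMeasure (moveLaw p) := by
  unfold moveLaw; infer_instance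

/-- The law of the i.i.d. sequence of peeling moves. -/
def movesLaw (p : unitInterval) : Measure (ℕ → Move) := Measure.infinitePi fun _ => moveLaw p

instance (p : unitInterval) : IsProbabilityMeasure (movesLaw p) := by
  unfold movesLaw; infer_instance

/-! ### The mixed boundary -/

/-- Admissible boundary conditions; the entry at index `j` is the colour of the vertex number
`j + 1`, counted from right to left. The first vertex is black, and no two adjacent vertices are
white. -/
def Admissible (s : ℕ → Colour) : Prop :=
  s 0 = black ∧ ∀ j, s j = white → s (j + 1) = black

/-- The space of admissible boundary conditions, with the product topology. -/
abbrev Boundary := {s : ℕ → Colour // Admissible s}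

/-- The list `l` followed by the sequence `s`. -/
def prepend (l : List Colour) (s : ℕ → Colour) : ℕ → Colour :=
  fun j => l[j]?.getD (s (j - l.length))

/-- Remove all the vertices in front of the first black vertex. -/
def skipWhite (s : ℕ → Colour) : ℕ → Colour := fun j => s (j + sInf {i | s i = black})

/-- The boundary to the left of the right end of the new face, read from right to left, is made
of the exposed vertices and of what remains of the old boundary; the new peeled edge is found by
following it up to the first black vertex. -/
def nextSeq (s : ℕ → Colour) (m : Move) : ℕ → Colour :=
  skipWhite (prepend m.colours fun j => s (j + m.1.swallowedLeft))

theorem colours_length (m : Move) : m.colours.length = m.1.exposed := by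
  rcases m with ⟨f, c, d⟩
  have : f.exposed ≤ 2 := by cases f <;> simp [Face.exposed] <;> split_ifs <;> simp
  simp [Move.colours, this]

theorem swallowedLeft_of_two_le {f : Face} (h : 2 ≤ f.exposed) :
    f.exposed = 2 ∧ f.swallowedLeft = 0 := by
  cases f
  case inner => exact ⟨rfl, rfl⟩
  all_goals
    exfalso
    simp only [Face.exposed] at h
    first | omega | (split_ifs at h <;> omega)

theorem admissible_nextSeq {s : ℕ → Colour} (hs : Admissible s) (m : Move) :
    Admissible (nextSeq s m) := by
  set t := prepend m.colours fun j => s (j + m.1.swallowedLeft) with ht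
  have tail : ∀ j, t (j + m.1.exposed) = s (j + m.1.swallowedLeft) := fun j => by
    simp [ht, prepend, ← colours_length]
  have hne : {i | t i = black}.Nonempty := by
    by_cases h : s m.1.swallowedLeft = black
    · exact ⟨0 + m.1.exposed, by rw [Set.mem_ofPred_eq, tail, zero_add]; exact h⟩
    · refine ⟨1 + m.1.exposed, ?_⟩
      have := hs.2 m.1.swallowedLeft (by simpa using h)
      rw [Set.mem_ofPred_eq, tail, add_comm]
      exact this
  have hN : t (sInf {i | t i = black}) = black := Nat.sInf_mem hne
  refine ⟨by simpa [nextSeq, skipWhite] using hN, fun j hj => ?_⟩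
  simp only [nextSeq, skipWhite, ← ht] at hj ⊢
  set N := sInf {i | t i = black}
  rcases le_or_gt m.1.exposed (j + N) with hle | hlt
  · obtain ⟨i, hi⟩ := Nat.exists_eq_add_of_le' hle
    rw [hi, tail] at hj
    have := hs.2 _ hj
    rw [show j + 1 + N = (i + 1) + m.1.exposed by omega, tail]
    rwa [show i + 1 + m.1.swallowedLeft = i + m.1.swallowedLeft + 1 by omega]
  · have hj0 : j ≠ 0 := by
      rintro rfl
      rw [zero_add, hN] at hj
      cases hj
    obtain ⟨h2, h0⟩ := swallowedLeft_of_two_le (f := m.1) (by omega)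
    rw [show j + 1 + N = 0 + m.1.exposed by omega, tail, h0]
    exact hs.1

/-- One step of the mixed boundary. -/
def next (ξ : Boundary) (m : Move) : Boundary := ⟨nextSeq ξ.1 m, admissible_nextSeq ξ.2 m⟩

/-- The chain `X_n` of mixed boundaries, started in `ξ` and driven by the moves `ω`. -/
def boundaryChain (ξ : Boundary) (ω : ℕ → Move) : ℕ → Boundary
  | 0 => ξ
  | n + 1 => next (boundaryChain ξ ω n) (ω n)

theorem measurable_skipWhite : Measurable skipWhite := by
  have hset : ∀ i : ℕ, MeasurableSet {s : ℕ → Colour | s i = black} := fun i =>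
    measurableSet_eq_fun (measurable_pi_apply i) measurable_const
  have hN : Measurable fun s : ℕ → Colour => sInf {i | s i = black} := by
    refine measurable_of_Ici fun n => ?_
    have : (fun s : ℕ → Colour => sInf {i | s i = black}) ⁻¹' Set.Ici n =
        ((⋂ i ∈ Set.Iio n, {s | s i = black}ᶜ) ∩ ⋃ i, {s | s i = black}) ∪
          {s | n = 0} := by
      ext s
      simp only [Set.mem_preimage, Set.mem_Ici, Set.mem_union, Set.mem_inter_iff, Set.mem_iInter,
        Set.mem_compl_iff, Set.mem_iUnion, Set.mem_ofPred_eq, Set.mem_Iio]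
      constructor
      · intro h
        by_cases hn : n = 0
        · exact Or.inr hn
        · refine Or.inl ⟨fun i hi hsi => ?_, ?_⟩
          · have := Nat.sInf_le (s := {i | s i = black}) hsi
            omega
          · exact Nat.nonempty_of_pos_sInf (s := {i | s i = black}) (by omega)
      · rintro (⟨h1, h2⟩ | h)
        · by_contra hlt
          exact h1 _ (not_le.1 hlt) (Nat.sInf_mem (s := {i | s i = black}) h2)
        · omega
    rw [this]
    exact ((MeasurableSet.biInter (Set.to_countable _) fun i _ => (hset i).compl).inter
      (MeasurableSet.iUnion hset)).union (MeasurableSet.const _)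
  refine measurable_pi_lambda _ fun j => ?_
  have hpair : Measurable fun z : (ℕ → Colour) × ℕ => z.1 (j + z.2) :=
    measurable_from_prod_countable_left fun n => measurable_pi_apply (j + n)
  exact hpair.comp (measurable_id.prodMk hN)

theorem measurable_next : Measurable fun z : Boundary × Move => next z.1 z.2 := by
  refine measurable_from_prod_countable_left fun m => ?_
  refine Measurable.subtype_mk ?_
  refine measurable_skipWhite.comp (measurable_pi_lambda _ fun j => ?_)
  simp only [prepend]
  rcases m.colours[j]? with _ | c
  · exact (measurable_pi_apply _).comp measurable_subtype_coe
  · exact measurable_const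

theorem measurable_boundaryChain (n : ℕ) :
    Measurable fun z : Boundary × (ℕ → Move) => boundaryChain z.1 z.2 n := by
  induction n with
  | zero => exact measurable_fst
  | succ n ih =>
    exact measurable_next.comp (ih.prodMk ((measurable_pi_apply n).comp measurable_snd))

/-- The law of `X_n` when `X_0` has law `ν` and is independent of the moves. -/
def boundaryLaw (p : unitInterval) (ν : ProbabilityMeasure Boundary) (n : ℕ) :
    ProbabilityMeasure Boundary :=
  ⟨((ν : Measure Boundary).prod (movesLaw p)).map fun z => boundaryChain z.1 z.2 n,
    Measure.isProbabilityMeasure_map (measurable_boundaryChain n).aemeasurable⟩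

/-- `μ` is an invariant distribution of the chain of mixed boundaries. -/
def IsInvariant (p : unitInterval) (μ : ProbabilityMeasure Boundary) : Prop :=
  boundaryLaw p μ 1 = μ

/-- The first `k` coordinates of a boundary condition. -/
def first (k : ℕ) (ξ : Boundary) : Fin k → Colour := fun i => ξ.1 i

/-- The law `[ν]_k` of the first `k` coordinates. -/
def firstLaw (k : ℕ) (ν : ProbabilityMeasure Boundary) : Measure (Fin k → Colour) :=
  (ν : Measure Boundary).map (first k)

/-- The total variation distance `sup_A |μ(A) - ν(A)|`, over all measurable `A`. -/
def tvDist {E : Type*} [MeasurableSpace E] (μ ν : Measure E) : ℝ :=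
  ⨆ A : {A : Set E // MeasurableSet A}, |μ.real A.1 - ν.real A.1|

/-! ### The flagged chain -/

/-- A finite sequence of colours that is non-empty, starts with black, and has no adjacent whites. -/
def FlagAdmissible (l : List Colour) : Prop :=
  l.head? = some black ∧ l.IsChain fun c d => c = white → d = black

/-- The countable state space of the flagged chain. -/
abbrev FlagState := {l : List Colour // FlagAdmissible l}

/-- One step of the flagged chain. The state `l` lists, from right to left, the colours of the
vertices between the peeled edge and the flagged edge, which are both excluded except for the left
end of the former and the right end of the latter. So the flagged edge is swallowed if at least
`l.length` edges are swallowed to the left. The flag is then reset to the edge just to the left of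
the new peeled edge, whose left end is black. The same is done if the flagged edge itself becomes
the peeled edge, which never happens to the chain started in a single black vertex, as then the
last entry of the state is always black. -/
def nextFlagList (l : List Colour) (m : Move) : List Colour :=
  if l.length ≤ m.1.swallowedLeft then [black]
  else
    let l' := (m.colours ++ l.drop m.1.swallowedLeft).dropWhile (· = white)
    if l' = [] then [black] else l'

theorem flagAdmissible_nextFlagList {l : List Colour} (hl : FlagAdmissible l) (m : Move) :
    FlagAdmissible (nextFlagList l m) := by
  have hb : FlagAdmissible [black] := by simp [FlagAdmissible]
  unfold nextFlagList
  split_ifs with h1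
  · exact hb
  dsimp only
  split_ifs with h2
  · exact hb
  refine ⟨?_, ?_⟩
  · have := List.head_dropWhile_not (p := fun c => decide (c = white)) h2
    rw [List.head?_eq_some_head h2]
    simpa using this
  have cons : ∀ L : List Colour, (L.IsChain fun c d => c = white → d = black) →
      (black :: L).IsChain fun c d => c = white → d = black := fun L hL => by
    cases L with
    | nil => simp
    | cons d L => exact List.isChain_cons_cons.2 ⟨by simp, hL⟩
  have drop : ∀ L : List Colour, (L.IsChain fun c d => c = white → d = black) →
      (L.dropWhile (· = white)).IsChain fun c d => c = white → d = black := fun L hL =>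
    hL.suffix (List.dropWhile_suffix _)
  have one : ∀ (c : Colour) (L : List Colour), (L.IsChain fun c d => c = white → d = black) →
      ((c :: L).dropWhile (· = white)).IsChain fun c d => c = white → d = black :=
    fun c L hL => by
      cases c with
      | true => simpa using drop L hL
      | false => simpa using cons L hL
  have hd : (l.drop m.1.swallowedLeft).IsChain fun c d => c = white → d = black :=
    hl.2.drop _
  rcases m with ⟨f, c, d⟩
  rcases lt_or_ge f.exposed 2 with hlt | hge
  · have : f.exposed = 0 ∨ f.exposed = 1 := by omega
    rcases this with h0 | h0
    · simpa [Move.colours, h0] using drop _ hd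
    · simpa [Move.colours, h0] using one c _ hd
  · obtain ⟨he, h0⟩ := swallowedLeft_of_two_le hge
    simp only [Move.colours, he, h0, List.drop_zero]
    obtain ⟨hh, hc⟩ := hl
    cases c with
    | true => simpa using one d _ hc
    | false =>
      cases l with
      | nil => simp at hh
      | cons x l =>
        have hx : x = black := by simpa using hh
        have : (d :: x :: l).IsChain fun c d => c = white → d = black :=
          List.isChain_cons_cons.2 ⟨fun _ => hx, hc⟩
        simpa using cons _ this

def nextFlag (x : FlagState) (m : Move) : FlagState :=
  ⟨nextFlagList x.1 m, flagAdmissible_nextFlagList x.2 m⟩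

/-- The flagged chain `X*_n`, started in `x` and driven by the moves `ω`. -/
def flagChain (x : FlagState) (ω : ℕ → Move) : ℕ → FlagState
  | 0 => x
  | n + 1 => nextFlag (flagChain x ω n) (ω n)

/-- The initial state `X*_0` of the flagged chain: a single black vertex. -/
def flagInit : FlagState := ⟨[black], by simp [FlagAdmissible]⟩

/-- The state `x` is recurrent: the chain started in `x` almost surely visits `x` infinitely
often. -/
def FlagRecurrent (p : unitInterval) (x : FlagState) : Prop :=
  ∀ᵐ ω ∂movesLaw p, ∃ᶠ n in atTop, flagChain x ω n = x

/-- The state `x` is transient: the chain started in `x` almost surely visits `x` only finitely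
often. -/
def FlagTransient (p : unitInterval) (x : FlagState) : Prop :=
  ∀ᵐ ω ∂movesLaw p, ¬ ∃ᶠ n in atTop, flagChain x ω n = x

/-- The first return time to `x` of the chain started in `x`, infinite if there is no return. -/
def returnTime (x : FlagState) (ω : ℕ → Move) : ℝ≥0∞ :=
  ⨅ (n : ℕ) (_ : 1 ≤ n ∧ flagChain x ω n = x), (n : ℝ≥0∞)

/-- The state `x` is null-recurrent: it is recurrent with infinite mean return time. -/
def FlagNullRecurrent (p : unitInterval) (x : FlagState) : Prop :=
  FlagRecurrent p x ∧ ∫⁻ ω, returnTime x ω ∂movesLaw p = ∞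

end Peeling

end

/-!
The flagged word `X*_n`, started from a single black vertex, forms the first letters of `X_n`
whatever the initial boundary is (`isInitial_flagChain`): up to the flag the boundary is determined
by the moves alone, and when the flag is swallowed it is put back on a vertex which is known to be
black. Two chains driven by the same moves thus agree on their first `k` letters as soon as
`X*_n` has at least `k` letters, so the laws of these letters differ by at most the probability
`shortProb p n k` that `X*_n` is shorter (`boundaryLaw_preimage_first_le`).

This probability tends to `0`. A word with fewer than `k` letters is swallowed in one step with
probability at least `q_k > 0`, so it suffices that the probability `u_n` of `X*_n` being the initial
state tends to `0`. In the transient case this is clear. In the null-recurrent case no aperiodic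
renewal theorem is needed: the dynamics preserves the prefix order of words
(`nextFlagList_isPrefix`), so restarting the flag at time one can only shorten the word, and `u_n`
is decreasing (`visitProb_antitone`). With `r_j` the probability of no return up to time `j`, the
decomposition at the last visit gives `∑_{k ≤ n} u_k r_{n-k} ≤ 1`, hence `u_n ∑_{j ≤ n} r_j ≤ 1`,
where `∑ r_j` is the mean return time, which is infinite.

Convergence on all cylinders is weak convergence, as the cylinders form a π-system of clopen
neighbourhoods (`tendsto_of_tendsto_of_cylinder`), so an invariant law attracts every initial law,
and is unique. For existence, the space of boundaries is compact, so the laws of `X_n` have a weak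
limit point; the transition operator is weakly continuous (`continuous_boundaryLaw_one`) and the
laws at consecutive times are asymptotically equal on cylinders, so the limit point is invariant.
-/

namespace Peeling

/-! ### The Markov property of the driven chains -/

/-- The moves `z.1` before time `k`, followed by the moves `z.2`. -/
def splice (k : ℕ) (z : (ℕ → Move) × (ℕ → Move)) : ℕ → Move :=
  fun n => if n < k then z.1 n else z.2 (n - k)

theorem measurePreserving_splice (p : unitInterval) (k : ℕ) :
    MeasurePreserving (splice k) ((movesLaw p).prod (movesLaw p)) (movesLaw p) := by
  have hm : Measurable (splice k) := by
    refine measurable_pi_lambda _ fun n => ?_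
    unfold splice
    split_ifs
    · exact (measurable_pi_apply n).comp measurable_fst
    · exact (measurable_pi_apply (n - k)).comp measurable_snd
  refine ⟨hm, Measure.eq_infinitePi _ fun s t ht => ?_⟩
  rw [Measure.map_apply hm (.pi s.countable_toSet fun i _ => ht i)]
  have hs : splice k ⁻¹' Set.pi s t = Set.pi (s.filter (· < k) : Finset ℕ) t ×ˢ
      Set.pi (((s.filter (¬ · < k)).image (· - k) : Finset ℕ) : Set ℕ) fun i => t (i + k) := by
    ext z
    simp only [Set.mem_preimage, Set.mem_pi, Set.mem_prod, splice, Finset.coe_filter,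
      Finset.coe_image, Set.mem_ofPred_eq, SetLike.mem_coe, Set.mem_image]
    constructor
    · refine fun h => ⟨fun i hi => by simpa [hi.2] using h i hi.1, ?_⟩
      rintro _ ⟨i, ⟨hi, hik⟩, rfl⟩
      have := h i hi
      rw [if_neg hik] at this
      rwa [Nat.sub_add_cancel (not_lt.1 hik)]
    · rintro ⟨h1, h2⟩ i hi
      split_ifs with hik
      · exact h1 i ⟨hi, hik⟩
      · have := h2 _ ⟨i, ⟨hi, hik⟩, rfl⟩
        rwa [Nat.sub_add_cancel (not_lt.1 hik)] at this
  rw [hs, Measure.prod_prod, movesLaw, Measure.infinitePi_pi _ fun i _ => ht i,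
    Measure.infinitePi_pi _ fun i _ => ht _, Finset.prod_image,
    ← Finset.prod_filter_mul_prod_filter_not s (· < k)]
  · congr 1
    refine Finset.prod_congr rfl fun i hi => ?_
    rw [Nat.sub_add_cancel (not_lt.1 (Finset.mem_filter.1 hi).2)]
  · intro i hi j hj hij
    have h1 := not_lt.1 (Finset.mem_filter.1 hi).2
    have h2 := not_lt.1 (Finset.mem_filter.1 hj).2
    have h3 : i - k = j - k := hij
    omega

theorem flagChain_congr {ω ω' : ℕ → Move} (x : FlagState) {n : ℕ} (h : ∀ i < n, ω i = ω' i) :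
    flagChain x ω n = flagChain x ω' n := by
  induction n with
  | zero => rfl
  | succ n ih => rw [flagChain, flagChain, ih fun i hi => h i (by omega), h n n.lt_succ_self]

theorem flagChain_splice (x : FlagState) (k n : ℕ) (z : (ℕ → Move) × (ℕ → Move)) :
    flagChain x (splice k z) (k + n) = flagChain (flagChain x z.1 k) z.2 n := by
  induction n with
  | zero => exact flagChain_congr x fun i hi => if_pos hi
  | succ n ih => rw [← add_assoc, flagChain, ih, flagChain]; simp [splice]

theorem boundaryChain_congr {ω ω' : ℕ → Move} (ξ : Boundary) {n : ℕ} (h : ∀ i < n, ω i = ω' i) :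
    boundaryChain ξ ω n = boundaryChain ξ ω' n := by
  induction n with
  | zero => rfl
  | succ n ih =>
    rw [boundaryChain, boundaryChain, ih fun i hi => h i (by omega), h n n.lt_succ_self]

theorem boundaryChain_splice (ξ : Boundary) (k n : ℕ) (z : (ℕ → Move) × (ℕ → Move)) :
    boundaryChain ξ (splice k z) (k + n) = boundaryChain (boundaryChain ξ z.1 k) z.2 n := by
  induction n with
  | zero => exact boundaryChain_congr ξ fun i hi => if_pos hi
  | succ n ih => rw [← add_assoc, boundaryChain, ih, boundaryChain]; simp [splice]

/-- The Chapman–Kolmogorov equation for the chain of mixed boundaries. -/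
theorem boundaryLaw_add (p : unitInterval) (ν : ProbabilityMeasure Boundary) (m n : ℕ) :
    boundaryLaw p ν (m + n) = boundaryLaw p (boundaryLaw p ν m) n := by
  refine Subtype.ext ?_
  have hm : MeasurePreserving (fun z : Boundary × (ℕ → Move) => boundaryChain z.1 z.2 m)
      ((ν : Measure Boundary).prod (movesLaw p)) (boundaryLaw p ν m : Measure Boundary) :=
    ⟨measurable_boundaryChain m, rfl⟩
  have h1 := (hm.prod (MeasurePreserving.id (movesLaw p))).map_eq
  have h2 := ((MeasurePreserving.id (ν : Measure Boundary)).prod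
    (measurePreserving_splice p m)).comp
      (measurePreserving_prodAssoc (ν : Measure Boundary) (movesLaw p) (movesLaw p))
  change Measure.map _ ((ν : Measure Boundary).prod (movesLaw p)) =
    Measure.map _ ((boundaryLaw p ν m : Measure Boundary).prod (movesLaw p))
  rw [← h1, Measure.map_map (measurable_boundaryChain _) (hm.measurable.prodMap measurable_id)]
  refine (congrArg (Measure.map fun z => boundaryChain z.1 z.2 (m + n)) h2.map_eq).symm.trans ?_
  rw [Measure.map_map (measurable_boundaryChain _) h2.measurable]
  congr 1
  funext z
  exact boundaryChain_splice _ _ _ _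

theorem measurableSet_flagChain (x : FlagState) (n : ℕ) (P : FlagState → Prop) :
    MeasurableSet {ω | P (flagChain x ω n)} := by
  induction n generalizing P with
  | zero => exact MeasurableSet.const (P x)
  | succ n ih =>
    have : {ω | P (flagChain x ω (n + 1))} =
        ⋃ m : Move, (fun ω : ℕ → Move => ω n) ⁻¹' {m} ∩
          {ω | P (nextFlag (flagChain x ω n) m)} := by
      ext ω
      simp [flagChain]
    rw [this]
    exact .iUnion fun m =>
      (measurable_pi_apply n (measurableSet_singleton m)).inter (ih fun y => P (nextFlag y m))

/-! ### The flagged word is a prefix of the boundary -/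

theorem FlagAdmissible.singleton_isPrefix {l : List Colour} (hl : FlagAdmissible l) :
    [black] <+: l := by
  obtain ⟨h, -⟩ := hl
  cases l with
  | nil => simp at h
  | cons c l => simpa using h.symm

/-- The dynamics of flagged words preserves the prefix order: as long as the flag of the shorter
word survives, what lies beyond it is left untouched, and after a reset that word is a single black
letter, with which every state begins. -/
theorem nextFlagList_isPrefix {l l' : List Colour} (h : l <+: l') (hl' : FlagAdmissible l')
    (m : Move) : nextFlagList l m <+: nextFlagList l' m := by
  have hb := (flagAdmissible_nextFlagList hl' m).singleton_isPrefix
  by_cases h1 : l.length ≤ m.1.swallowedLeft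
  · rwa [nextFlagList, if_pos h1]
  by_cases h2 : (m.colours ++ l.drop m.1.swallowedLeft).dropWhile (· = white) = []
  · rwa [nextFlagList, if_neg h1, if_pos h2]
  obtain ⟨t, rfl⟩ := h
  have h3 : ¬ (l ++ t).length ≤ m.1.swallowedLeft := by simp; omega
  have h4 : (m.colours ++ (l ++ t).drop m.1.swallowedLeft).dropWhile (· = white) =
      (m.colours ++ l.drop m.1.swallowedLeft).dropWhile (· = white) ++ t := by
    rw [List.drop_append_of_le_length (by omega), ← List.append_assoc, List.dropWhile_append,
      if_neg (by simpa [List.isEmpty_iff] using h2)]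
  have h5 : (m.colours ++ l.drop m.1.swallowedLeft).dropWhile (· = white) ++ t ≠ [] := by
    simp only [ne_eq, List.append_eq_nil_iff, not_and]
    exact fun h => absurd h h2
  rw [nextFlagList, if_neg h1, if_neg h2, nextFlagList, if_neg h3, h4, if_neg h5]
  exact List.prefix_append _ _

theorem flagChain_isPrefix {x y : FlagState} (h : x.1 <+: y.1) (ω : ℕ → Move) (n : ℕ) :
    (flagChain x ω n).1 <+: (flagChain y ω n).1 := by
  induction n with
  | zero => exact h
  | succ n ih => exact nextFlagList_isPrefix ih (flagChain y ω n).2 _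

theorem prepend_apply_of_lt {l : List Colour} (s : ℕ → Colour) {j : ℕ} (h : j < l.length) :
    prepend l s j = l[j] := by
  simp [prepend, h]

theorem prepend_apply_add (l : List Colour) (s : ℕ → Colour) (j : ℕ) :
    prepend l s (l.length + j) = s j := by
  simp [prepend]

theorem prepend_append (l l' : List Colour) (s : ℕ → Colour) :
    prepend (l ++ l') s = prepend l (prepend l' s) := by
  funext j
  rcases lt_or_ge j l.length with h | h
  · simp [prepend, List.getElem?_append, h]
  · simp [prepend, List.getElem?_append, not_lt.2 h, Nat.sub_sub]

theorem prepend_shift {l : List Colour} {k : ℕ} (h : k ≤ l.length) (s : ℕ → Colour) :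
    (fun j => prepend l s (j + k)) = prepend (l.drop k) s := by
  have hk : (l.take k).length = k := by simpa using h
  funext j
  conv_lhs => rw [← List.take_append_drop k l, prepend_append]
  have := prepend_apply_add (l.take k) (prepend (l.drop k) s) j
  rwa [hk, add_comm] at this

theorem skipWhite_of_black {s : ℕ → Colour} (h : s 0 = black) : skipWhite s = s := by
  have : sInf {i | s i = black} = 0 := by
    simp [Nat.sInf_eq_zero, h]
  funext j
  simp [skipWhite, this]

theorem skipWhite_of_white {s : ℕ → Colour} (h : s 0 = white) (hs : ∃ i, s i = black) :
    skipWhite s = skipWhite fun j => s (j + 1) := by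
  have hne : {i | s i = black}.Nonempty := hs
  have h1 : 1 ≤ sInf {i | s i = black} := by
    refine Nat.one_le_iff_ne_zero.2 fun h0 => ?_
    have := Nat.sInf_mem hne
    rw [h0, Set.mem_ofPred_eq, h] at this
    cases this
  have := Nat.sInf_add (p := fun i => s i = black) h1
  funext j
  have e : sInf {i | s i = black} = sInf {i | s (i + 1) = black} + 1 := this.symm
  simp [skipWhite, e, add_assoc]

theorem skipWhite_prepend {l : List Colour} (h : l.dropWhile (· = white) ≠ [])
    (s : ℕ → Colour) : skipWhite (prepend l s) = prepend (l.dropWhile (· = white)) s := by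
  induction l with
  | nil => simp at h
  | cons c l ih =>
    cases c with
    | false => exact skipWhite_of_black (by simp [prepend])
    | true =>
      have h' : l.dropWhile (· = white) ≠ [] := by simpa using h
      have e : (fun j => prepend (white :: l) s (j + 1)) = prepend l s :=
        prepend_shift (k := 1) (by simp) s
      rw [skipWhite_of_white (by simp [prepend]), e, ih h']
      · simp
      · obtain ⟨i, hi, hb⟩ : ∃ i, ∃ h : i < l.length, l[i] = black := by
          have hm := List.dropWhile_subset _ (List.head_mem h')
          have hw := List.head_dropWhile_not (p := fun c => decide (c = white)) h'
          obtain ⟨i, hi, hb⟩ := List.getElem_of_mem hm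
          exact ⟨i, hi, by rw [hb]; simpa using hw⟩
        exact ⟨i + 1, by rw [congrFun e i, prepend_apply_of_lt s hi, hb]⟩

/-- The word `l` can be read off the first entries of `s`. -/
def IsInitial (l : List Colour) (s : ℕ → Colour) : Prop := ∃ t, s = prepend l t

theorem IsInitial.apply {l : List Colour} {s : ℕ → Colour} (h : IsInitial l s) {j : ℕ}
    (hj : j < l.length) : s j = l[j] := by
  obtain ⟨t, rfl⟩ := h
  exact prepend_apply_of_lt t hj

theorem isInitial_singleton {s : ℕ → Colour} (h : s 0 = black) : IsInitial [black] s := by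
  refine ⟨fun j => s (j + 1), funext fun j => ?_⟩
  cases j <;> simp [prepend, h]

theorem IsInitial.next {l : List Colour} {s : ℕ → Colour} (h : IsInitial l s)
    (hs : Admissible s) (m : Move) : IsInitial (nextFlagList l m) (nextSeq s m) := by
  have hb := isInitial_singleton (admissible_nextSeq hs m).1
  by_cases h1 : l.length ≤ m.1.swallowedLeft
  · rwa [nextFlagList, if_pos h1]
  by_cases h2 : (m.colours ++ l.drop m.1.swallowedLeft).dropWhile (· = white) = []
  · rwa [nextFlagList, if_neg h1, if_pos h2]
  obtain ⟨t, rfl⟩ := h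
  rw [nextFlagList, if_neg h1, if_neg h2]
  refine ⟨t, ?_⟩
  rw [nextSeq, prepend_shift (by omega), ← prepend_append, skipWhite_prepend h2]

/-- Whatever the initial boundary is, the flagged word started from a single black vertex forms the
first entries of the boundary. -/
theorem isInitial_flagChain (ξ : Boundary) (ω : ℕ → Move) (n : ℕ) :
    IsInitial (flagChain flagInit ω n).1 (boundaryChain ξ ω n).1 := by
  induction n with
  | zero => exact isInitial_singleton ξ.2.1
  | succ n ih => exact ih.next (boundaryChain ξ ω n).2 _

/-! ### The flagged word becomes long -/

/-- The probability that the flagged chain is in its initial state at time `n`. -/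
noncomputable def visitProb (p : unitInterval) (n : ℕ) : ℝ≥0∞ :=
  movesLaw p {ω | flagChain flagInit ω n = flagInit}

/-- The event that the flagged chain does not return to its initial state up to time `n`. -/
def noReturn (n : ℕ) : Set (ℕ → Move) :=
  {ω | ∀ i, 1 ≤ i → i ≤ n → flagChain flagInit ω i ≠ flagInit}

theorem measurableSet_noReturn (n : ℕ) : MeasurableSet (noReturn n) := by
  have : noReturn n = ⋂ i, ⋂ (_ : 1 ≤ i), ⋂ (_ : i ≤ n),
      {ω | flagChain flagInit ω i ≠ flagInit} := by
    ext ω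
    simp [noReturn]
  rw [this]
  exact .iInter fun i => .iInter fun _ => .iInter fun _ =>
    measurableSet_flagChain flagInit i (· ≠ flagInit)

/-- Restarting the flag at time one can only make the flagged word shorter, because prefixes are
preserved by the dynamics. -/
theorem visitProb_antitone (p : unitInterval) : Antitone (visitProb p) := by
  refine antitone_nat_of_succ_le fun n => ?_
  have h := measurePreserving_splice p 1
  have hms := fun n => measurableSet_flagChain flagInit n (· = flagInit)
  rw [visitProb, ← h.measure_preimage (hms _).nullMeasurableSet,
    ← one_mul (visitProb p n), visitProb, ← measure_univ (μ := movesLaw p), ← Measure.prod_prod]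
  refine measure_mono fun z hz => ⟨trivial, ?_⟩
  have hz' : flagChain (flagChain flagInit z.1 1) z.2 n = flagInit := by
    rw [← flagChain_splice, add_comm]
    exact hz
  have h1 := flagChain_isPrefix (x := flagInit)
    (flagChain flagInit z.1 1).2.singleton_isPrefix z.2 n
  rw [hz'] at h1
  exact Subtype.ext (h1.eq_of_length_le (flagChain flagInit z.2 n).2.singleton_isPrefix.length_le)

/-- The events that the last visit up to time `n` takes place at time `k` are disjoint. -/
theorem sum_visitProb_mul_noReturn_le (p : unitInterval) (n : ℕ) :
    ∑ k ∈ Finset.range (n + 1), visitProb p k * movesLaw p (noReturn (n - k)) ≤ 1 := by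
  set A : ℕ → Set (ℕ → Move) := fun k => {ω | flagChain flagInit ω k = flagInit} ∩
    ⋂ i, ⋂ (_ : 1 ≤ i), ⋂ (_ : i ≤ n - k), {ω | flagChain flagInit ω (k + i) ≠ flagInit} with hA
  have hAm : ∀ k, MeasurableSet (A k) := fun k =>
    (measurableSet_flagChain flagInit k (· = flagInit)).inter <|
      .iInter fun i => .iInter fun _ => .iInter fun _ =>
        measurableSet_flagChain flagInit (k + i) (· ≠ flagInit)
  -- `A k` is the event that `k` is the last visit to the initial state up to time `n`.
  have hAμ : ∀ k, visitProb p k * movesLaw p (noReturn (n - k)) = movesLaw p (A k) := by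
    intro k
    rw [visitProb, ← Measure.prod_prod,
      ← (measurePreserving_splice p k).measure_preimage (hAm k).nullMeasurableSet]
    congr 1
    ext z
    have h0 := flagChain_splice flagInit k 0 z
    rw [add_zero, flagChain] at h0
    simp only [hA, Set.mem_prod, Set.mem_preimage, Set.mem_inter_iff, Set.mem_iInter,
      Set.mem_ofPred_eq, noReturn, h0, flagChain_splice]
    refine and_congr_right fun h => ?_
    rw [h]
  simp only [hAμ]
  rw [← measure_univ (μ := movesLaw p)]
  refine sum_measure_le_measure_univ (fun k _ => (hAm k).nullMeasurableSet) ?_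
  have hlt : ∀ k k', k < k' → k' ≤ n → Disjoint (A k) (A k') := by
    intro k k' h h'
    refine Set.disjoint_left.2 fun ω h1 h2 => ?_
    have h3 := h1.2
    simp only [Set.mem_iInter, Set.mem_ofPred_eq] at h3
    refine h3 (k' - k) (by omega) (by omega) ?_
    rw [Nat.add_sub_cancel' h.le]
    exact h2.1
  intro k hk k' hk' hne
  simp only [Finset.coe_range, Set.mem_Iio] at hk hk'
  refine Disjoint.aedisjoint ?_
  rcases lt_or_gt_of_ne hne with h | h
  · exact hlt _ _ h (by omega)
  · exact (hlt _ _ h (by omega)).symm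

/-- The event `noReturn n` means that the return time exceeds `n`, and a time with values
in `ℕ ∪ {∞}` is the sum of the indicators of the events that it exceeds `0, 1, 2, …`. -/
theorem returnTime_le (ω : ℕ → Move) :
    returnTime flagInit ω ≤ ∑' n, (noReturn n).indicator 1 ω := by
  classical
  by_cases h : ∃ n, 1 ≤ n ∧ flagChain flagInit ω n = flagInit
  · have hN := Nat.find_spec h
    calc returnTime flagInit ω ≤ (Nat.find h : ℝ≥0∞) :=
          iInf₂_le (f := fun (n : ℕ) (_ : 1 ≤ n ∧ flagChain flagInit ω n = flagInit) =>
            (n : ℝ≥0∞)) _ hN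
      _ = ∑ n ∈ Finset.range (Nat.find h), (noReturn n).indicator (1 : (ℕ → Move) → ℝ≥0∞) ω := by
        rw [Finset.sum_congr rfl (g := fun _ => (1 : ℝ≥0∞))]
        · simp
        · intro n hn
          refine Set.indicator_of_mem (s := noReturn n) (fun i h1 h2 h3 => ?_) _
          exact Nat.find_min h (h2.trans_lt (Finset.mem_range.1 hn)) ⟨h1, h3⟩
      _ ≤ _ := ENNReal.sum_le_tsum _
  · have : ∀ n, (noReturn n).indicator (1 : (ℕ → Move) → ℝ≥0∞) ω = 1 := fun n =>
      Set.indicator_of_mem (s := noReturn n) (fun i h1 _ h3 => h ⟨i, h1, h3⟩) _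
    simp [this]

theorem tendsto_visitProb_of_transient {p : unitInterval} (h : FlagTransient p flagInit) :
    Tendsto (visitProb p) atTop (𝓝 0) := by
  rw [← measure_empty (μ := movesLaw p)]
  refine tendsto_measure_of_ae_tendsto_indicator_of_isFiniteMeasure atTop .empty
    (fun n => measurableSet_flagChain flagInit n (· = flagInit)) ?_
  filter_upwards [h] with ω hω
  simpa [not_frequently] using hω

/-- As the visit probabilities decrease, the decomposition with respect to the last visit bounds
them by the inverse of the truncated mean return time. -/
theorem tendsto_visitProb_of_lintegral_eq_top {p : unitInterval}
    (h : ∫⁻ ω, returnTime flagInit ω ∂movesLaw p = ∞) :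
    Tendsto (visitProb p) atTop (𝓝 0) := by
  have htop : ∑' n, movesLaw p (noReturn n) = ∞ := by
    rw [eq_top_iff, ← h]
    refine (lintegral_mono returnTime_le).trans_eq ?_
    rw [lintegral_tsum fun n => (measurable_one.indicator (measurableSet_noReturn n)).aemeasurable]
    simp only [lintegral_indicator_one (measurableSet_noReturn _)]
  have hlim := (ENNReal.tendsto_nat_tsum fun n => movesLaw p (noReturn n)).comp
    (tendsto_add_atTop_nat 1)
  rw [htop] at hlim
  have hinv := hlim.inv
  rw [ENNReal.inv_top] at hinv
  refine tendsto_of_tendsto_of_tendsto_of_le_of_le tendsto_const_nhds hinv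
    (fun _ => zero_le) fun n => ?_
  rw [ENNReal.le_inv_iff_mul_le]
  refine le_trans ?_ (sum_visitProb_mul_noReturn_le p n)
  simp only [Function.comp_apply]
  rw [← Finset.sum_range_reflect, Finset.mul_sum]
  refine Finset.sum_le_sum fun k hk => ?_
  rw [show n + 1 - 1 - k = n - k by omega]
  gcongr
  exact visitProb_antitone p (Nat.lt_succ_iff.1 (Finset.mem_range.1 hk))

theorem q_pos (n : ℕ) : 0 < q n := by
  have : 0 < Z (n / 2 + 1) := by unfold Z; split_ifs <;> positivity
  unfold q rho alpha
  positivity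

theorem moveLaw_left_pos (p : unitInterval) (k : ℕ) :
    0 < moveLaw p {m | m.1 = Face.left k} := by
  have : {m : Move | m.1 = Face.left k} = {Face.left k} ×ˢ Set.univ := by
    ext m; simp
  rw [this, moveLaw, Measure.prod_prod, measure_univ, mul_one,
    PMF.toMeasure_apply_singleton _ _ (measurableSet_singleton _)]
  exact ENNReal.ofReal_pos.2 (q_pos k)

/-- The probability that the flagged word has fewer than `k` letters at time `n`. -/
noncomputable def shortProb (p : unitInterval) (n k : ℕ) : ℝ≥0∞ :=
  movesLaw p {ω | (flagChain flagInit ω n).1.length < k}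

/-- A word with fewer than `k` letters is swallowed in a single step with probability at least
`q_k`, so that it cannot be more frequent than the initial state at the next time. -/
theorem shortProb_mul_le (p : unitInterval) (n k : ℕ) :
    shortProb p n k * moveLaw p {m | m.1 = Face.left k} ≤ visitProb p (n + 1) := by
  have hproj : moveLaw p {m | m.1 = Face.left k} =
      movesLaw p ((fun ω => ω 0) ⁻¹' {m | m.1 = Face.left k}) :=
    ((measurePreserving_eval_infinitePi (fun _ : ℕ => moveLaw p) 0).measure_preimage
      (measurable_fst (measurableSet_singleton (Face.left k))).nullMeasurableSet).symm
  rw [hproj, shortProb, ← Measure.prod_prod, visitProb,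
    ← (measurePreserving_splice p n).measure_preimage
      (measurableSet_flagChain flagInit (n + 1) (· = flagInit)).nullMeasurableSet]
  refine measure_mono fun z hz => ?_
  obtain ⟨h1, h2⟩ := hz
  rw [Set.mem_preimage, Set.mem_ofPred_eq, flagChain_splice]
  refine Subtype.ext ?_
  simp only [Set.mem_preimage, Set.mem_ofPred_eq] at h1 h2
  simp only [flagChain, nextFlag, nextFlagList, h2, Face.swallowedLeft]
  exact if_pos h1.le

theorem tendsto_shortProb {p : unitInterval}
    (h : FlagTransient p flagInit ∨ FlagNullRecurrent p flagInit) (k : ℕ) :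
    Tendsto (fun n => shortProb p n k) atTop (𝓝 0) := by
  have hv : Tendsto (visitProb p) atTop (𝓝 0) :=
    h.elim tendsto_visitProb_of_transient fun h => tendsto_visitProb_of_lintegral_eq_top h.2
  have hc := (moveLaw_left_pos p k).ne'
  have hc' : moveLaw p {m | m.1 = Face.left k} ≠ ∞ := measure_ne_top _ _
  have hlim := ENNReal.Tendsto.div_const (hv.comp (tendsto_add_atTop_nat 1)) (Or.inr hc)
  rw [ENNReal.zero_div] at hlim
  refine tendsto_of_tendsto_of_tendsto_of_le_of_le tendsto_const_nhds hlim
    (fun _ => zero_le) fun n => ?_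
  exact (ENNReal.le_div_iff_mul_le (Or.inl hc) (Or.inl hc')).2 (shortProb_mul_le p n k)

/-! ### Coupling of two initial conditions -/

theorem measurable_first (k : ℕ) : Measurable (first k) :=
  measurable_pi_lambda _ fun i => (measurable_pi_apply (i : ℕ)).comp measurable_subtype_coe

/-- The chains started from two initial boundaries and driven by the same moves agree on the
flagged word. -/
theorem boundaryLaw_preimage_first_le (p : unitInterval) (ν ν' : ProbabilityMeasure Boundary)
    (n k : ℕ) (A : Set (Fin k → Colour)) :
    (boundaryLaw p ν n : Measure Boundary) (first k ⁻¹' A) ≤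
      (boundaryLaw p ν' n : Measure Boundary) (first k ⁻¹' A) + shortProb p n k := by
  have hA : MeasurableSet (first k ⁻¹' A) := measurable_first k A.toFinite.measurableSet
  -- The letters beyond the end of the word are irrelevant: `getD` supplies an arbitrary default.
  set G : Set (ℕ → Move) := {ω | k ≤ (flagChain flagInit ω n).1.length ∧
    (fun i : Fin k => (flagChain flagInit ω n).1[(i : ℕ)]?.getD black) ∈ A} with hG
  have key : ∀ (ξ : Boundary) (ω : ℕ → Move), k ≤ (flagChain flagInit ω n).1.length →
      first k (boundaryChain ξ ω n) =
        fun i : Fin k => (flagChain flagInit ω n).1[(i : ℕ)]?.getD black := by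
    intro ξ ω h
    funext i
    have hi : (i : ℕ) < (flagChain flagInit ω n).1.length := i.2.trans_le h
    rw [first, (isInitial_flagChain ξ ω n).apply hi]
    simp [hi]
  have hmap : ∀ ν : ProbabilityMeasure Boundary,
      (boundaryLaw p ν n : Measure Boundary) (first k ⁻¹' A) =
        ((ν : Measure Boundary).prod (movesLaw p))
          ((fun z => boundaryChain z.1 z.2 n) ⁻¹' (first k ⁻¹' A)) := fun ν =>
    Measure.map_apply (measurable_boundaryChain n) hA
  have huniv : ∀ (ν : ProbabilityMeasure Boundary) (S : Set (ℕ → Move)),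
      ((ν : Measure Boundary).prod (movesLaw p)) (Set.univ ×ˢ S) = movesLaw p S := fun ν S => by
    rw [Measure.prod_prod, measure_univ, one_mul]
  calc (boundaryLaw p ν n : Measure Boundary) (first k ⁻¹' A)
      ≤ ((ν : Measure Boundary).prod (movesLaw p))
          (Set.univ ×ˢ (G ∪ {ω | (flagChain flagInit ω n).1.length < k})) := by
        rw [hmap]
        refine measure_mono fun z hz => ⟨trivial, ?_⟩
        rcases lt_or_ge (flagChain flagInit z.2 n).1.length k with h | h
        · exact Or.inr h
        · refine Or.inl ⟨h, ?_⟩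
          rw [← key z.1 z.2 h]
          exact hz
    _ ≤ movesLaw p G + shortProb p n k := by
        rw [huniv]
        exact measure_union_le _ _
    _ ≤ _ := by
        rw [← huniv ν' G, hmap]
        gcongr
        intro z hz
        have hz' : first k (boundaryChain z.1 z.2 n) ∈ A := by
          rw [key z.1 z.2 hz.2.1]
          exact hz.2.2
        exact hz'

theorem shortProb_ne_top (p : unitInterval) (n k : ℕ) : shortProb p n k ≠ ∞ :=
  measure_ne_top _ _

theorem abs_boundaryLaw_sub_le (p : unitInterval) (ν ν' : ProbabilityMeasure Boundary)
    (n k : ℕ) (A : Set (Fin k → Colour)) :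
    |(boundaryLaw p ν n : Measure Boundary).real (first k ⁻¹' A) -
      (boundaryLaw p ν' n : Measure Boundary).real (first k ⁻¹' A)| ≤ (shortProb p n k).toReal := by
  have key : ∀ ν ν' : ProbabilityMeasure Boundary,
      (boundaryLaw p ν n : Measure Boundary).real (first k ⁻¹' A) ≤
        (boundaryLaw p ν' n : Measure Boundary).real (first k ⁻¹' A) +
          (shortProb p n k).toReal := fun ν ν' => by
    rw [Measure.real, Measure.real,
      ← ENNReal.toReal_add (measure_ne_top _ _) (shortProb_ne_top p n k)]
    exact ENNReal.toReal_mono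
      (ENNReal.add_ne_top.2 ⟨measure_ne_top _ _, shortProb_ne_top p n k⟩)
      (boundaryLaw_preimage_first_le p ν ν' n k A)
  rw [abs_sub_le_iff]
  exact ⟨by linarith [key ν ν'], by linarith [key ν' ν]⟩

theorem tvDist_firstLaw_le (p : unitInterval) (ν ν' : ProbabilityMeasure Boundary) (n k : ℕ) :
    tvDist (firstLaw k (boundaryLaw p ν n)) (firstLaw k (boundaryLaw p ν' n)) ≤
      (shortProb p n k).toReal := by
  have : Nonempty {A : Set (Fin k → Colour) // MeasurableSet A} := ⟨⟨∅, .empty⟩⟩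
  refine ciSup_le fun A => ?_
  rw [firstLaw, firstLaw, map_measureReal_apply (measurable_first k) A.2,
    map_measureReal_apply (measurable_first k) A.2]
  exact abs_boundaryLaw_sub_le p ν ν' n k A

theorem tvDist_nonneg {E : Type*} [MeasurableSpace E] (μ ν : Measure E) : 0 ≤ tvDist μ ν :=
  Real.iSup_nonneg fun _ => abs_nonneg _

/-! ### Weak convergence on the space of boundaries -/

theorem isClosed_admissible : IsClosed {s : ℕ → Colour | Admissible s} := by
  have : {s : ℕ → Colour | Admissible s} =
      {s | s 0 = black} ∩ ⋂ j, {s | s j = white → s (j + 1) = black} := by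
    ext s
    simp [Admissible]
  rw [this]
  refine (isClosed_eq (continuous_apply 0) continuous_const).inter
    (isClosed_iInter fun j => ?_)
  have hc : Continuous fun s : ℕ → Colour => (s j, s (j + 1)) := by fun_prop
  exact (isClosed_discrete {c : Colour × Colour | c.1 = white → c.2 = black}).preimage hc

instance : CompactSpace Boundary :=
  isCompact_iff_compactSpace.1 isClosed_admissible.isCompact

instance : SecondCountableTopology Boundary :=
  Topology.IsEmbedding.subtypeVal.secondCountableTopology

instance : TopologicalSpace.PseudoMetrizableSpace Boundary :=
  TopologicalSpace.PseudoMetrizableSpace.of_regularSpace_secondCountableTopology _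

theorem continuous_first (k : ℕ) : Continuous (first k) :=
  continuous_pi fun i => (continuous_apply (i : ℕ)).comp continuous_subtype_val

theorem isClopen_preimage_first (k : ℕ) (A : Set (Fin k → Colour)) :
    IsClopen (first k ⁻¹' A) :=
  (isClopen_discrete A).preimage (continuous_first k)

theorem isPiSystem_preimage_first :
    IsPiSystem {s : Set Boundary | ∃ k A, s = first k ⁻¹' A} := by
  rintro _ ⟨k, A, rfl⟩ _ ⟨k', A', rfl⟩ -
  refine ⟨max k k', {c | (fun i : Fin k => c (i.castLE (le_max_left k k'))) ∈ A ∧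
    (fun i : Fin k' => c (i.castLE (le_max_right k k'))) ∈ A'}, ?_⟩
  ext ξ
  rfl

theorem exists_preimage_first_subset {u : Set Boundary} (hu : IsOpen u) {ξ : Boundary}
    (hξ : ξ ∈ u) : ∃ k, first k ⁻¹' {first k ξ} ⊆ u := by
  obtain ⟨v, hv, rfl⟩ := isOpen_induced_iff.1 hu
  obtain ⟨I, w, hw, hIw⟩ := isOpen_pi_iff.1 hv ξ.1 hξ
  refine ⟨I.sup id + 1, fun η hη => hIw fun i hi => ?_⟩
  have hi' : i < I.sup id + 1 := Nat.lt_succ_iff.2 (Finset.le_sup (f := id) hi)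
  have h : η.1 i = ξ.1 i := congrFun hη ⟨i, hi'⟩
  rw [h]
  exact (hw i hi).2

/-- Two sequences of laws on boundaries which asymptotically agree on all cylinders have the same
weak limits. -/
theorem tendsto_of_tendsto_of_cylinder {a b : ℕ → ProbabilityMeasure Boundary}
    {μ : ProbabilityMeasure Boundary} (ha : Tendsto a atTop (𝓝 μ))
    (hab : ∀ k (A : Set (Fin k → Colour)), Tendsto (fun n =>
      (a n : Measure Boundary).real (first k ⁻¹' A) -
        (b n : Measure Boundary).real (first k ⁻¹' A)) atTop (𝓝 0)) :
    Tendsto b atTop (𝓝 μ) := by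
  refine isPiSystem_preimage_first.tendsto_probabilityMeasure_of_tendsto_of_mem ?_ ?_ ?_
  · rintro _ ⟨k, A, rfl⟩
    exact (isClopen_preimage_first k A).isOpen.measurableSet
  · intro u hu ξ hξ
    obtain ⟨k, hk⟩ := exists_preimage_first_subset hu hξ
    exact ⟨_, ⟨k, {first k ξ}, rfl⟩, (isClopen_preimage_first k _).isOpen.mem_nhds rfl, hk⟩
  · rintro _ ⟨k, A, rfl⟩
    have h1 := ProbabilityMeasure.tendsto_measure_of_isClopen_of_tendsto ha
      (isClopen_preimage_first k A)
    rw [← NNReal.tendsto_coe] at h1 ⊢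
    have h2 := h1.sub (hab k A)
    rw [sub_zero] at h2
    refine h2.congr fun n => ?_
    exact sub_sub_cancel _ _

/-! ### The Feller property -/

/-- Only the entries up to the first black one decide how much is removed, and these are constant
in a neighbourhood of the sequence. -/
theorem continuousAt_skipWhite {s : ℕ → Colour} (hs : ∃ i, s i = black) :
    ContinuousAt skipWhite s := by
  set N := sInf {i | s i = black} with hN
  have hev : ∀ᶠ s' in 𝓝 s, ∀ i ∈ Finset.range (N + 1), s' i = s i := by
    rw [Finset.eventually_all]
    exact fun i _ => (continuous_apply i).continuousAt.eventually (eventually_mem_set.2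
      ((isOpen_discrete {s i}).mem_nhds rfl))
  have hsN : s N = black := Nat.sInf_mem (s := {i | s i = black}) hs
  refine continuousAt_pi.2 fun j => ?_
  refine ContinuousAt.congr (continuous_apply (j + N)).continuousAt ?_
  filter_upwards [hev] with s' hs'
  have h1 : sInf {i | s' i = black} = N := by
    refine le_antisymm (Nat.sInf_le ?_) ?_
    · rw [Set.mem_ofPred_eq, hs' N (by simp), hsN]
    · refine le_csInf ⟨N, by rw [Set.mem_ofPred_eq, hs' N (by simp), hsN]⟩ fun i hi => ?_
      by_contra hlt
      have h2 := hs' i (by simp; omega)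
      rw [Set.mem_ofPred_eq, h2] at hi
      exact Nat.notMem_of_lt_sInf (not_le.1 hlt) hi
  simp only [skipWhite, h1]

theorem continuous_next (m : Move) : Continuous fun ξ : Boundary => next ξ m := by
  refine Continuous.subtype_mk (continuous_iff_continuousAt.2 fun ξ => ?_) _
  refine ContinuousAt.comp (g := skipWhite)
    (f := fun ξ : Boundary => prepend m.colours fun j => ξ.1 (j + m.1.swallowedLeft)) ?_ ?_
  · exact continuousAt_skipWhite ⟨_, (admissible_nextSeq ξ.2 m).1⟩
  · refine (continuous_pi fun j => ?_).continuousAt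
    simp only [prepend]
    rcases m.colours[j]? with _ | c
    · exact (continuous_apply _).comp continuous_subtype_val
    · exact continuous_const

/-- The transition operator of the chain is continuous for weak convergence. -/
theorem continuous_boundaryLaw_one (p : unitInterval) :
    Continuous fun ν : ProbabilityMeasure Boundary => boundaryLaw p ν 1 := by
  refine continuous_iff_continuousAt.2 fun ν => ?_
  refine ProbabilityMeasure.tendsto_iff_forall_integral_tendsto.2 fun f => ?_
  have hmeas : Measurable fun z : Boundary × (ℕ → Move) => f (boundaryChain z.1 z.2 1) :=
    f.continuous.measurable.comp (measurable_boundaryChain 1)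
  have hg : Continuous fun ξ : Boundary => ∫ ω, f (boundaryChain ξ ω 1) ∂movesLaw p := by
    refine continuous_of_dominated (bound := fun _ => ‖f‖)
      (fun ξ => (hmeas.comp measurable_prodMk_left).aestronglyMeasurable)
      (fun ξ => .of_forall fun ω => f.norm_coe_le_norm _) (integrable_const _)
      (.of_forall fun ω => f.continuous.comp (continuous_next (ω 0)))
  have hint : ∀ ν : ProbabilityMeasure Boundary, ∫ ξ, f ξ ∂(boundaryLaw p ν 1 : Measure Boundary) =
      ∫ ξ, BoundedContinuousFunction.mkOfCompact ⟨_, hg⟩ ξ ∂(ν : Measure Boundary) := fun ν => by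
    refine (integral_map (measurable_boundaryChain 1).aemeasurable
      f.continuous.measurable.aestronglyMeasurable).trans ?_
    refine integral_prod (fun z : Boundary × (ℕ → Move) => f (boundaryChain z.1 z.2 1)) ?_
    exact Integrable.of_bound hmeas.aestronglyMeasurable ‖f‖
      (.of_forall fun z => f.norm_coe_le_norm _)
  simp only [hint]
  exact ProbabilityMeasure.tendsto_iff_forall_integral_tendsto.1 tendsto_id _

/-! ### The invariant law -/

theorem IsInvariant.boundaryLaw_eq {p : unitInterval} {μ : ProbabilityMeasure Boundary}
    (h : IsInvariant p μ) (n : ℕ) : boundaryLaw p μ n = μ := by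
  induction n with
  | zero =>
    refine Subtype.ext ?_
    change Measure.map Prod.fst ((μ : Measure Boundary).prod (movesLaw p)) = μ
    exact measurePreserving_fst.map_eq
  | succ n ih => rw [boundaryLaw_add, ih, h]

/-- The laws of the chains started from two initial laws asymptotically agree on cylinders. -/
theorem tendsto_boundaryLaw_sub {p : unitInterval}
    (hs : ∀ k, Tendsto (fun n => shortProb p n k) atTop (𝓝 0))
    (ν ν' : ProbabilityMeasure Boundary) (k : ℕ) (A : Set (Fin k → Colour)) :
    Tendsto (fun n => (boundaryLaw p ν n : Measure Boundary).real (first k ⁻¹' A) -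
      (boundaryLaw p ν' n : Measure Boundary).real (first k ⁻¹' A)) atTop (𝓝 0) :=
  squeeze_zero_norm (fun n => abs_boundaryLaw_sub_le p ν ν' n k A)
    ((ENNReal.tendsto_toReal_zero_iff fun n => shortProb_ne_top p n k).2 (hs k))

theorem tendsto_boundaryLaw_of_isInvariant {p : unitInterval}
    (hs : ∀ k, Tendsto (fun n => shortProb p n k) atTop (𝓝 0))
    {μ : ProbabilityMeasure Boundary} (hμ : IsInvariant p μ) (ν : ProbabilityMeasure Boundary) :
    Tendsto (fun n => boundaryLaw p ν n) atTop (𝓝 μ) := by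
  refine tendsto_of_tendsto_of_cylinder (a := fun n => boundaryLaw p μ n) ?_
    fun k A => tendsto_boundaryLaw_sub hs μ ν k A
  simp only [hμ.boundaryLaw_eq]
  exact tendsto_const_nhds

/-- Every weak limit point of the laws of the chain started from a fixed boundary is invariant. -/
theorem exists_isInvariant {p : unitInterval}
    (hs : ∀ k, Tendsto (fun n => shortProb p n k) atTop (𝓝 0)) :
    ∃ μ : ProbabilityMeasure Boundary, IsInvariant p μ := by
  let ξ : Boundary := ⟨fun _ => black, rfl, fun _ _ => rfl⟩
  let ν : ProbabilityMeasure Boundary := ⟨Measure.dirac ξ, inferInstance⟩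
  obtain ⟨μ, φ, hφ, hlim⟩ := CompactSpace.tendsto_subseq fun n => boundaryLaw p ν n
  refine ⟨μ, tendsto_nhds_unique
    (((continuous_boundaryLaw_one p).tendsto μ).comp hlim) ?_⟩
  refine tendsto_of_tendsto_of_cylinder hlim fun k A => ?_
  refine ((tendsto_boundaryLaw_sub hs ν (boundaryLaw p ν 1) k A).comp hφ.tendsto_atTop).congr
    fun n => ?_
  simp only [Function.comp_apply]
  rw [← boundaryLaw_add, ← boundaryLaw_add, add_comm]

end Peeling

open Peeling in
/-- In the transient and null-recurrent cases there is exactly one invariant distribution `μ`, and,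
whatever the law `ν` of the initial state is, the law of the first `k` coordinates of `X_n` converges
in total variation to that of `μ`, and `X_n` converges in law to `μ`. -/
theorem proposition3p4 (p : unitInterval)
    (h : FlagTransient p flagInit ∨ FlagNullRecurrent p flagInit) :
    (∃! μ : ProbabilityMeasure Boundary, IsInvariant p μ) ∧
    ∀ μ : ProbabilityMeasure Boundary, IsInvariant p μ →
      ∀ ν : ProbabilityMeasure Boundary,
        (∀ k : ℕ, 1 ≤ k →
          Tendsto (fun n => tvDist (firstLaw k (boundaryLaw p ν n)) (firstLaw k μ)) atTop (𝓝 0)) ∧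
        Tendsto (fun n => boundaryLaw p ν n) atTop (𝓝 μ) := by
  have hs := tendsto_shortProb h
  obtain ⟨μ, hμ⟩ := exists_isInvariant hs
  refine ⟨⟨μ, hμ, fun μ' hμ' => tendsto_nhds_unique
    (tendsto_boundaryLaw_of_isInvariant hs hμ' μ) (tendsto_boundaryLaw_of_isInvariant hs hμ μ)⟩,
    fun μ hμ ν => ⟨fun k _ => ?_, tendsto_boundaryLaw_of_isInvariant hs hμ ν⟩⟩
  refine squeeze_zero (fun n => tvDist_nonneg _ _) (fun n => ?_)
    ((ENNReal.tendsto_toReal_zero_iff fun n => shortProb_ne_top p n k).2 (hs k))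
  have := tvDist_firstLaw_le p ν μ n k
  rwa [hμ.boundaryLaw_eq] at this
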